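/- Let $n \ge 1$ be an integer, $1 < p < \infty$ and $\theta \ge 0$. A weight function on $\mathbb{R}^n$ is a measurable, locally integrable function $a : \mathbb{R}^n \to [0,\infty)$ that vanishes at most on a set of Lebesgue measure zero. For a weight function $a$, the generalized grand Lebesgue space $L_a^{p),\theta}(\mathbb{R}^n)$ is the complex normed space of all (classes of almost everywhere equal) measurable functions $f : \mathbb{R}^n \to \mathbb{C}$ with $$\|f\|_{L_a^{p),\theta}} = \sup_{0<\varepsilon\le p-1} \varepsilon^{\theta} \left( \int_{\mathbb{R}^n} |f(x)|^{p-\varepsilon}\, a(x)^{\varepsilon/p}\, dx \right)^{\frac{1}{p-\varepsilon}} < \infty .$$ The space $L_a^{p),\theta}(\mathbb{R}^n)$ is in general not reflexive: for every such $n$, $p$ and $\theta$ there exists a weight function $a$ on $\mathbb{R}^n$ such that the canonical map of $L_a^{p),\theta}(\mathbb{R}^n)$ into its topological bidual is not surjective. -/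

import Mathlib

open MeasureTheory Set
open scoped ENNReal

noncomputable section

/-- A weight function on `ℝⁿ`: a measurable, locally integrable function with values in `[0, ∞)`
that vanishes at most on a set of Lebesgue measure zero. -/
structure Weight (n : ℕ) where
  toFun : EuclideanSpace ℝ (Fin n) → ℝ
  measurable' : Measurable toFun
  locallyIntegrable' : LocallyIntegrable toFun volume
  nonneg' : ∀ x, 0 ≤ toFun x
  ae_pos' : ∀ᵐ x ∂(volume : Measure (EuclideanSpace ℝ (Fin n))), 0 < toFun x

instance {n : ℕ} : CoeFun (Weight n) (fun _ => EuclideanSpace ℝ (Fin n) → ℝ) :=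
  ⟨Weight.toFun⟩

/-- The generalized grand Lebesgue norm, with values in `[0, ∞]`:
`sup_{0 < ε ≤ p - 1} ε ^ θ * (∫ |f x| ^ (p - ε) * a x ^ (ε / p) dx) ^ (1 / (p - ε))`. -/
def grandENorm {n : ℕ} (p θ : ℝ) (a : Weight n) (f : EuclideanSpace ℝ (Fin n) → ℂ) : ℝ≥0∞ :=
  ⨆ ε ∈ Ioc (0 : ℝ) (p - 1),
    ENNReal.ofReal (ε ^ θ) *
      (∫⁻ x, ‖f x‖ₑ ^ (p - ε) * ENNReal.ofReal (a x ^ (ε / p))) ^ (1 / (p - ε))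

section lemmas

variable {n : ℕ} {p θ : ℝ} {a : Weight n}

/-- Each term of the supremum is an `L^(p - ε)` norm for the measure `a ^ (ε / p) dx`. -/
theorem grandENorm_term_eq {ε : ℝ} (hε : ε ∈ Ioc (0 : ℝ) (p - 1))
    (f : EuclideanSpace ℝ (Fin n) → ℂ) :
    (∫⁻ x, ‖f x‖ₑ ^ (p - ε) * ENNReal.ofReal (a x ^ (ε / p))) ^ (1 / (p - ε)) =
      eLpNorm f (ENNReal.ofReal (p - ε))
        (volume.withDensity fun x => ENNReal.ofReal (a x ^ (ε / p))) := by
  have h1 : 1 ≤ p - ε := by linarith [hε.2]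
  have hm : Measurable fun x => ENNReal.ofReal (a x ^ (ε / p)) :=
    (a.measurable'.pow_const _).ennreal_ofReal
  rw [eLpNorm_eq_lintegral_rpow_enorm_toReal (by simp; linarith) (by simp),
    ENNReal.toReal_ofReal (by linarith),
    lintegral_withDensity_eq_lintegral_mul_non_measurable _ hm
      (Filter.Eventually.of_forall fun x => ENNReal.ofReal_lt_top)]
  simp only [Pi.mul_apply, mul_comm]

theorem grandENorm_congr {f g : EuclideanSpace ℝ (Fin n) → ℂ} (h : f =ᵐ[volume] g) :
    grandENorm p θ a f = grandENorm p θ a g := by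
  unfold grandENorm
  refine iSup_congr fun ε => iSup_congr fun _ => ?_
  congr 2
  apply lintegral_congr_ae
  filter_upwards [h] with x hx
  rw [hx]

theorem grandENorm_zero : grandENorm p θ a (0 : EuclideanSpace ℝ (Fin n) → ℂ) = 0 := by
  unfold grandENorm
  simp only [ENNReal.iSup_eq_zero]
  intro ε hε
  rw [grandENorm_term_eq hε, eLpNorm_zero, mul_zero]

theorem grandENorm_add_le {f g : EuclideanSpace ℝ (Fin n) → ℂ}
    (hf : AEStronglyMeasurable f volume) (hg : AEStronglyMeasurable g volume) :
    grandENorm p θ a (f + g) ≤ grandENorm p θ a f + grandENorm p θ a g := by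
  refine iSup₂_le fun ε hε => ?_
  have hac := withDensity_absolutelyContinuous
    (volume : Measure (EuclideanSpace ℝ (Fin n))) (fun x => ENNReal.ofReal (a x ^ (ε / p)))
  have h1 : 1 ≤ ENNReal.ofReal (p - ε) := by
    rw [ENNReal.one_le_ofReal]; linarith [hε.2]
  rw [grandENorm_term_eq hε]
  calc _ ≤ ENNReal.ofReal (ε ^ θ) * (_ + _) := by
        gcongr
        exact eLpNorm_add_le (hf.mono_ac hac) (hg.mono_ac hac) h1
    _ = _ := mul_add _ _ _
    _ ≤ _ := by
        rw [← grandENorm_term_eq hε, ← grandENorm_term_eq hε]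
        exact add_le_add
          (le_iSup₂ (f := fun (ε : ℝ) (_ : ε ∈ Ioc (0 : ℝ) (p - 1)) =>
            ENNReal.ofReal (ε ^ θ) *
              (∫⁻ x, ‖f x‖ₑ ^ (p - ε) * ENNReal.ofReal (a x ^ (ε / p))) ^ (1 / (p - ε))) ε hε)
          (le_iSup₂ (f := fun (ε : ℝ) (_ : ε ∈ Ioc (0 : ℝ) (p - 1)) =>
            ENNReal.ofReal (ε ^ θ) *
              (∫⁻ x, ‖g x‖ₑ ^ (p - ε) * ENNReal.ofReal (a x ^ (ε / p))) ^ (1 / (p - ε))) ε hε)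

theorem grandENorm_const_smul (c : ℂ) (f : EuclideanSpace ℝ (Fin n) → ℂ) :
    grandENorm p θ a (c • f) = ‖c‖ₑ * grandENorm p θ a f := by
  unfold grandENorm
  simp only [ENNReal.mul_iSup]
  refine iSup_congr fun ε => iSup_congr fun hε => ?_
  rw [grandENorm_term_eq hε, grandENorm_term_eq hε, eLpNorm_const_smul, mul_left_comm]

theorem ae_eq_zero_of_grandENorm_eq_zero (hp : 1 < p) {f : EuclideanSpace ℝ (Fin n) → ℂ}
    (hf : AEStronglyMeasurable f volume) (h : grandENorm p θ a f = 0) : f =ᵐ[volume] 0 := by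
  have hε : p - 1 ∈ Ioc (0 : ℝ) (p - 1) := ⟨by linarith, le_rfl⟩
  unfold grandENorm at h
  simp only [ENNReal.iSup_eq_zero] at h
  have h1 := h (p - 1) hε
  have hpos : ENNReal.ofReal ((p - 1) ^ θ) ≠ 0 := by
    simpa using Real.rpow_pos_of_pos hε.1 θ
  have h2 := (mul_eq_zero.mp h1).resolve_left hpos
  have e1 : p - (p - 1) = 1 := by ring
  rw [e1] at h2
  simp only [ENNReal.rpow_one, div_one] at h2
  have h3 := (lintegral_eq_zero_iff' (hf.enorm.mul
    ((a.measurable'.pow_const ((p - 1) / p)).ennreal_ofReal.aemeasurable))).mp h2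
  filter_upwards [h3, a.ae_pos'] with x hx hax
  have hw : ENNReal.ofReal (a x ^ ((p - 1) / p)) ≠ 0 := by
    simpa using Real.rpow_pos_of_pos hax _
  simpa using (mul_eq_zero.mp hx).resolve_right hw

end lemmas

/-- The generalized grand Lebesgue space `L_a^{p),θ}(ℝⁿ)`: the (classes of almost everywhere equal)
measurable functions `f : ℝⁿ → ℂ` with finite generalized grand Lebesgue norm. -/
def GrandLebesgue {n : ℕ} (p θ : ℝ) (a : Weight n) :
    Submodule ℂ (EuclideanSpace ℝ (Fin n) →ₘ[volume] ℂ) where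
  carrier := {f | grandENorm p θ a f < ∞}
  zero_mem' := by
    rw [mem_ofPred_eq, grandENorm_congr AEEqFun.coeFn_zero, grandENorm_zero]
    exact ENNReal.zero_lt_top
  add_mem' := fun {f g} hf hg => by
    rw [mem_ofPred_eq, grandENorm_congr (AEEqFun.coeFn_add f g)]
    exact (grandENorm_add_le f.aestronglyMeasurable g.aestronglyMeasurable).trans_lt
      (ENNReal.add_lt_top.mpr ⟨hf, hg⟩)
  smul_mem' := fun c f hf => by
    rw [mem_ofPred_eq, grandENorm_congr (AEEqFun.coeFn_smul c f), grandENorm_const_smul]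
    exact ENNReal.mul_lt_top enorm_lt_top hf

section space

variable {n : ℕ} {p θ : ℝ} {a : Weight n}

theorem GrandLebesgue.toReal_smul_eq (c : ℂ) (f : GrandLebesgue p θ a) :
    (grandENorm p θ a (c • f).1).toReal = ‖c‖ * (grandENorm p θ a f.1).toReal := by
  rw [Submodule.coe_smul, grandENorm_congr (AEEqFun.coeFn_smul c f.1),
    grandENorm_const_smul, ENNReal.toReal_mul, toReal_enorm]

/-- `L_a^{p),θ}(ℝⁿ)` is normed by the generalized grand Lebesgue norm. -/
instance [hp : Fact (1 < p)] : NormedAddCommGroup (GrandLebesgue p θ a) :=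
  AddGroupNorm.toNormedAddCommGroup
    { toFun := fun f => (grandENorm p θ a f.1).toReal
      map_zero' := by
        rw [Submodule.coe_zero, grandENorm_congr AEEqFun.coeFn_zero,
          grandENorm_zero, ENNReal.toReal_zero]
      add_le' := fun f g => by
        rw [Submodule.coe_add, grandENorm_congr (AEEqFun.coeFn_add f.1 g.1),
          ← ENNReal.toReal_add f.2.ne g.2.ne]
        exact ENNReal.toReal_mono (ENNReal.add_ne_top.mpr ⟨f.2.ne, g.2.ne⟩)
          (grandENorm_add_le f.1.aestronglyMeasurable g.1.aestronglyMeasurable)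
      neg' := fun f => by
        have h := GrandLebesgue.toReal_smul_eq (-1 : ℂ) f
        rwa [neg_one_smul ℂ f, norm_neg, norm_one, one_mul] at h
      eq_zero_of_map_eq_zero' := fun f hf => by
        have h0 : grandENorm p θ a f.1 = 0 :=
          ((ENNReal.toReal_eq_zero_iff _).mp hf).resolve_right f.2.ne
        apply Subtype.ext
        apply AEEqFun.ext
        exact (ae_eq_zero_of_grandENorm_eq_zero hp.out f.1.aestronglyMeasurable h0).trans
          AEEqFun.coeFn_zero.symm }

instance [Fact (1 < p)] : NormedSpace ℂ (GrandLebesgue p θ a) where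
  norm_smul_le c f := (GrandLebesgue.toReal_smul_eq c f).le

theorem GrandLebesgue.norm_def [Fact (1 < p)] (f : GrandLebesgue p θ a) :
    ‖f‖ = (grandENorm p θ a f.1).toReal := rfl

end space

/-- A normed space is reflexive if the canonical map into its topological bidual is onto. -/
def IsReflexiveSpace (𝕜 X : Type*) [RCLike 𝕜] [NormedAddCommGroup X] [NormedSpace 𝕜 X] : Prop :=
  Function.Surjective (NormedSpace.inclusionInDoubleDual 𝕜 X)

end

open Filter Topology

/-- In a reflexive space, a bounded sequence has a weak cluster point: a vector at which every
functional converging along the sequence takes its limit. -/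
theorem IsReflexiveSpace.exists_forall_tendsto {𝕜 X : Type*} [RCLike 𝕜] [NormedAddCommGroup X]
    [NormedSpace 𝕜 X] (h : IsReflexiveSpace 𝕜 X) {e : ℕ → X} {C : ℝ} (he : ∀ k, ‖e k‖ ≤ C) :
    ∃ f : X, ∀ (φ : StrongDual 𝕜 X) (c : 𝕜),
      Tendsto (fun k => φ (e k)) atTop (𝓝 c) → φ f = c := by
  let J : ℕ → WeakDual 𝕜 (StrongDual 𝕜 X) := fun k =>
    StrongDual.toWeakDual (NormedSpace.inclusionInDoubleDual 𝕜 X (e k))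
  have hK := WeakDual.isCompact_closedBall (𝕜 := 𝕜) (E := StrongDual 𝕜 X) 0 C
  have hJ : ∀ k, J k ∈ WeakDual.toStrongDual ⁻¹' Metric.closedBall 0 C := fun k =>
    mem_preimage.2 (Metric.mem_closedBall.2
      ((dist_zero_right (NormedSpace.inclusionInDoubleDual 𝕜 X (e k))).trans_le
        ((NormedSpace.double_dual_bound 𝕜 X (e k)).trans (he k))))
  obtain ⟨Φ, -, hΦ⟩ := hK.exists_mapClusterPt (f := atTop) (u := J)
    (tendsto_principal.2 (Eventually.of_forall hJ))
  obtain ⟨f, hf⟩ := h (WeakDual.toStrongDual Φ)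
  refine ⟨f, fun φ c hc => ?_⟩
  have h1 : MapClusterPt (Φ φ) atTop (fun k => φ (e k)) :=
    hΦ.continuousAt_comp (WeakDual.eval_continuous φ).continuousAt
  have h2 : φ f = Φ φ := by
    have := congrArg (fun T : StrongDual 𝕜 (StrongDual 𝕜 X) => T φ) hf
    simpa using this
  rw [h2]
  exact eq_of_nhds_neBot (h1.neBot.mono (inf_le_inf_left _ hc))

/-- The weight that is constantly one. -/
noncomputable def Weight.one (n : ℕ) : Weight n where
  toFun := fun _ => 1
  measurable' := measurable_const
  locallyIntegrable' := locallyIntegrable_const 1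
  nonneg' := fun _ => zero_le_one
  ae_pos' := Eventually.of_forall fun _ => one_pos

section unweighted

variable {n : ℕ} {p θ : ℝ}

theorem grandENorm_one (f : EuclideanSpace ℝ (Fin n) → ℂ) :
    grandENorm p θ (Weight.one n) f = ⨆ ε ∈ Ioc (0 : ℝ) (p - 1),
      ENNReal.ofReal (ε ^ θ) * (∫⁻ x, ‖f x‖ₑ ^ (p - ε)) ^ (1 / (p - ε)) := by
  simp [grandENorm, Weight.one]

/-- The grand Lebesgue norm with weight one controls the `L¹` norm. -/
theorem lintegral_enorm_le_grandENorm_one (hp : 1 < p) (f : EuclideanSpace ℝ (Fin n) → ℂ) :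
    ENNReal.ofReal ((p - 1) ^ θ) * ∫⁻ x, ‖f x‖ₑ ≤ grandENorm p θ (Weight.one n) f := by
  rw [grandENorm_one]
  have h := le_iSup₂ (f := fun (ε : ℝ) (_ : ε ∈ Ioc (0 : ℝ) (p - 1)) =>
    ENNReal.ofReal (ε ^ θ) * (∫⁻ x, ‖f x‖ₑ ^ (p - ε)) ^ (1 / (p - ε))) (p - 1)
    ⟨by linarith, le_rfl⟩
  simpa using h

theorem grandENorm_one_indicator_le (hθ : 0 ≤ θ) {s : Set (EuclideanSpace ℝ (Fin n))}
    (hs : MeasurableSet s) :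
    grandENorm p θ (Weight.one n) (s.indicator 1) ≤
      ENNReal.ofReal ((p - 1) ^ θ) * max 1 (volume s) := by
  rw [grandENorm_one]
  refine iSup₂_le fun ε hε => ?_
  have hr : 1 ≤ p - ε := by linarith [hε.2]
  have h1 : ∀ x, ‖s.indicator (1 : EuclideanSpace ℝ (Fin n) → ℂ) x‖ₑ ^ (p - ε) =
      s.indicator 1 x := fun x => by
    by_cases hx : x ∈ s
    · simp [hx]
    · simp [hx]; linarith
  simp only [h1, lintegral_indicator_one hs]
  gcongr
  · exact hε.1.le
  · exact hε.2
  · calc volume s ^ (1 / (p - ε)) ≤ max 1 (volume s) ^ (1 / (p - ε)) := by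
          gcongr
          exact le_max_right _ _
      _ ≤ max 1 (volume s) ^ (1 : ℝ) :=
          ENNReal.rpow_le_rpow_of_exponent_le (le_max_left _ _)
            ((div_le_one (by linarith)).2 hr)
      _ = _ := ENNReal.rpow_one _

theorem grandENorm_mk_indicator_lt_top (hθ : 0 ≤ θ) {s : Set (EuclideanSpace ℝ (Fin n))}
    (hs : MeasurableSet s) (hv : volume s ≠ ∞) :
    grandENorm p θ (Weight.one n) (AEEqFun.mk (s.indicator (1 : EuclideanSpace ℝ (Fin n) → ℂ))
      (stronglyMeasurable_one.indicator hs).aestronglyMeasurable : _ →ₘ[volume] ℂ) < ∞ := by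
  rw [grandENorm_congr (AEEqFun.coeFn_mk _ _)]
  exact (grandENorm_one_indicator_le hθ hs).trans_lt
    (ENNReal.mul_lt_top ENNReal.ofReal_lt_top (max_lt ENNReal.one_lt_top hv.lt_top))

variable [hp : Fact (1 < p)]

theorem GrandLebesgue.integrable_one (f : GrandLebesgue p θ (Weight.one n)) :
    Integrable f.1 := by
  refine ⟨f.1.aestronglyMeasurable, ?_⟩
  have hpos : ENNReal.ofReal ((p - 1) ^ θ) ≠ 0 := by
    simpa using Real.rpow_pos_of_pos (sub_pos.2 hp.out) θ
  by_contra h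
  have h' : ∫⁻ x, ‖f.1 x‖ₑ = ∞ := not_lt_top_iff.1 h
  have := lintegral_enorm_le_grandENorm_one (θ := θ) hp.out f.1
  rw [h', ENNReal.mul_top hpos] at this
  exact f.2.ne (top_le_iff.1 this)

theorem GrandLebesgue.integral_norm_le_norm (f : GrandLebesgue p θ (Weight.one n)) :
    (p - 1) ^ θ * ∫ x, ‖f.1 x‖ ≤ ‖f‖ := by
  have h := ENNReal.toReal_mono f.2.ne (lintegral_enorm_le_grandENorm_one (θ := θ) hp.out f.1)
  rwa [ENNReal.toReal_mul, ENNReal.toReal_ofReal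
    (Real.rpow_nonneg (sub_pos.2 hp.out).le θ),
    ← integral_norm_eq_lintegral_enorm f.1.aestronglyMeasurable] at h

/-- Integration over a set, as a continuous functional on the unweighted grand Lebesgue space. -/
noncomputable def GrandLebesgue.setIntegralCLM (s : Set (EuclideanSpace ℝ (Fin n))) :
    StrongDual ℂ (GrandLebesgue p θ (Weight.one n)) :=
  LinearMap.mkContinuous
    { toFun := fun f => ∫ x in s, f.1 x
      map_add' := fun f g => by
        rw [← integral_add (integrable_one f).integrableOn (integrable_one g).integrableOn]
        exact integral_congr_ae (ae_restrict_of_ae (AEEqFun.coeFn_add f.1 g.1))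
      map_smul' := fun c f => by
        rw [RingHom.id_apply, ← integral_smul]
        exact integral_congr_ae (ae_restrict_of_ae (AEEqFun.coeFn_smul c f.1)) }
    (((p - 1) ^ θ)⁻¹) fun f => by
      have hpos : 0 < (p - 1) ^ θ := Real.rpow_pos_of_pos (sub_pos.2 hp.out) θ
      rw [inv_mul_eq_div, le_div_iff₀' hpos]
      refine le_trans ?_ (integral_norm_le_norm f)
      gcongr
      exact (norm_integral_le_integral_norm _).trans
        (setIntegral_le_integral (integrable_one f).norm
          (Eventually.of_forall fun x => norm_nonneg _))

theorem GrandLebesgue.setIntegralCLM_apply (s : Set (EuclideanSpace ℝ (Fin n)))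
    (f : GrandLebesgue p θ (Weight.one n)) :
    setIntegralCLM s f = ∫ x in s, f.1 x := rfl

/-- The indicator function of a set of finite measure, in the unweighted grand Lebesgue space. -/
noncomputable def GrandLebesgue.indicator (hθ : 0 ≤ θ) {s : Set (EuclideanSpace ℝ (Fin n))}
    (hs : MeasurableSet s) (hv : volume s ≠ ∞) : GrandLebesgue p θ (Weight.one n) :=
  ⟨AEEqFun.mk (s.indicator 1) (stronglyMeasurable_one.indicator hs).aestronglyMeasurable,
    grandENorm_mk_indicator_lt_top hθ hs hv⟩

theorem GrandLebesgue.norm_indicator_le (hθ : 0 ≤ θ) {s : Set (EuclideanSpace ℝ (Fin n))}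
    (hs : MeasurableSet s) (hv : volume s ≠ ∞) :
    ‖(indicator hθ hs hv : GrandLebesgue p θ (Weight.one n))‖ ≤
      (ENNReal.ofReal ((p - 1) ^ θ) * max 1 (volume s)).toReal := by
  refine ENNReal.toReal_mono
    (ENNReal.mul_lt_top ENNReal.ofReal_lt_top (max_lt ENNReal.one_lt_top hv.lt_top)).ne ?_
  rw [indicator, grandENorm_congr (AEEqFun.coeFn_mk _ _)]
  exact grandENorm_one_indicator_le hθ hs

theorem GrandLebesgue.setIntegralCLM_indicator (hθ : 0 ≤ θ)
    {s : Set (EuclideanSpace ℝ (Fin n))} (hs : MeasurableSet s) (hv : volume s ≠ ∞)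
    (t : Set (EuclideanSpace ℝ (Fin n))) :
    setIntegralCLM t (indicator hθ hs hv : GrandLebesgue p θ (Weight.one n)) =
      volume.real (t ∩ s) := by
  rw [setIntegralCLM_apply, indicator,
    integral_congr_ae (ae_restrict_of_ae (AEEqFun.coeFn_mk _ _)), setIntegral_indicator hs]
  simp

end unweighted

/-- For the weight one, indicators of unit balls escaping to infinity have no weak cluster point. -/
theorem GrandLebesgue.not_isReflexiveSpace_one {n : ℕ} (hn : 1 ≤ n) {p θ : ℝ} [Fact (1 < p)]
    (hθ : 0 ≤ θ) : ¬ IsReflexiveSpace ℂ (GrandLebesgue p θ (Weight.one n)) := by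
  intro href
  let E := EuclideanSpace ℝ (Fin n)
  let c : ℕ → E := fun k => PiLp.single 2 ⟨0, hn⟩ (k : ℝ)
  have hc : ∀ k, ‖c k‖ = k := fun k => by
    rw [PiLp.norm_single, Real.norm_natCast]
  have hvol : ∀ k, volume (Metric.ball (c k) 1) = volume (Metric.ball (0 : E) 1) := fun k =>
    Measure.addHaar_ball_center _ _ _
  let e : ℕ → GrandLebesgue p θ (Weight.one n) := fun k =>
    indicator hθ (Metric.isOpen_ball (x := c k) (ε := 1)).measurableSet measure_ball_lt_top.ne
  obtain ⟨f, hf⟩ := href.exists_forall_tendsto (e := e)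
    (C := (ENNReal.ofReal ((p - 1) ^ θ) * max 1 (volume (Metric.ball (0 : E) 1))).toReal)
    fun k => (norm_indicator_le hθ _ _).trans_eq (by rw [hvol])
  have hzero : ∀ R : ℕ, ∫ x in Metric.ball (0 : E) R, f.1 x = 0 := fun R => by
    rw [← setIntegralCLM_apply]
    refine hf _ _ (tendsto_const_nhds.congr' ?_)
    filter_upwards [eventually_ge_atTop (R + 1)] with k hk
    have hd : Disjoint (Metric.ball (0 : E) R) (Metric.ball (c k) 1) := by
      refine Metric.ball_disjoint_ball ?_
      rw [dist_zero_left, hc]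
      exact_mod_cast hk
    rw [setIntegralCLM_indicator, hd.inter_eq]
    simp
  have htotal : ∫ x, f.1 x = volume.real (Metric.ball (0 : E) 1) := by
    rw [← setIntegral_univ, ← setIntegralCLM_apply]
    refine hf _ _ (tendsto_const_nhds.congr fun k => ?_)
    rw [setIntegralCLM_indicator, univ_inter, Measure.real, Measure.real, hvol]
  have hunion : ⋃ R : ℕ, Metric.ball (0 : E) R = univ := Metric.iUnion_ball_nat 0
  have hlim := tendsto_setIntegral_of_monotone (μ := volume) (f := f.1)
    (s := fun R : ℕ => Metric.ball (0 : E) R) (fun _ => Metric.isOpen_ball.measurableSet)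
    (fun _ _ h => Metric.ball_subset_ball (Nat.cast_le.2 h)) (integrable_one f).integrableOn
  rw [hunion, setIntegral_univ, htotal] at hlim
  have h0 : volume.real (Metric.ball (0 : E) 1) = 0 := by
    exact_mod_cast tendsto_nhds_unique hlim
      (tendsto_const_nhds.congr fun R => (hzero R).symm)
  exact (ENNReal.toReal_pos (Metric.measure_ball_pos volume (0 : E) one_pos).ne'
    measure_ball_lt_top.ne).ne' h0

theorem corollary2 (n : ℕ) (hn : 1 ≤ n) (p : ℝ) [Fact (1 < p)] (θ : ℝ) (hθ : 0 ≤ θ) :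
    ∃ a : Weight n, ¬ IsReflexiveSpace ℂ (GrandLebesgue p θ a) :=
  ⟨Weight.one n, GrandLebesgue.not_isReflexiveSpace_one hn hθ⟩
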